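/- Let $\mathbb{R}_{\max}=\mathbb{R}\cup\{\varepsilon\}$ with $\varepsilon=-\infty$, $a\oplus b=\max\{a,b\}$ and $a\otimes b=a+b$, extended to matrices and vectors in the usual way ($[A\otimes B](i,j)=\max_k(A(i,k)+B(k,j))$, $[\alpha\otimes A](i,j)=\alpha+A(i,j)$); write $A^{\otimes k}$ for the $k$-th max-plus power of a square matrix ($A^{\otimes 0}$ has $0$ on the diagonal and $\varepsilon$ elsewhere), and $A^{\otimes k}(\cdot,i)$ for its $i$-th column. Let $A\in\mathbb{R}_{\max}^{n\times n}$ be regular, i.e. each row of $A$ has at least one finite element. Let $\lambda\in\mathbb{R}$ be the maximum eigenvalue of $A$, i.e. the largest $a\in\mathbb{R}_{\max}$ for which there is a $v\in\mathbb{R}_{\max}^n$, not identically $\varepsilon$, with $A\otimes v=a\otimes v$, and suppose that the eigenspace $E(A)=\{x\in\mathbb{R}^n \mid A\otimes x=\lambda\otimes x\}$ is not empty. Suppose that there exist $i\in\{1,\dots,n\}$, integers $k_0'\ge 0$ and $c'\ge 1$, and a real number $\mu<\lambda$ such that \[A^{\otimes (k+c')}(\cdot,i)=(\mu c')\otimes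 A^{\otimes k}(\cdot,i)\quad\text{for all } k\ge k_0',\] where the column $A^{\otimes k_0'}(\cdot,i)$ has at least one finite element. Then the max-plus linear system $\mathbf{x}(k+1)=A\otimes\mathbf{x}(k)$ is unboundedly periodic, that is: (1) each initial vector $\mathbf{x}(0)\in\mathbb{R}^n$ has a local transient: there is a smallest integer $k_0\ge 0$ such that for some integer $c\ge 1$ we have $\mathbf{x}(k+c)=(\lambda c)\otimes\mathbf{x}(k)$ for all $k\ge k_0$; (2) $A$ has no global transient: there are no integers $k_0\ge 0$ and $c\ge 1$ such that $A^{\otimes(k+c)}=(\lambda c)\otimes A^{\otimes k}$ for all $k\ge k_0$. -/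

import Mathlib

namespace MaxPlus

/-- The max-plus semiring `ℝ ∪ {-∞}` as an ordered set: `ε = -∞` is `⊥`, the max-plus sum is
the maximum `⊔`, and the max-plus product is the usual `+` (with `⊥ + a = a + ⊥ = ⊥`). -/
abbrev Rmax : Type := WithBot ℝ

variable {n : ℕ}

/-- A real vector, regarded as a vector over `Rmax`. -/
def toRmax (x : Fin n → ℝ) : Fin n → Rmax := fun i => (x i : Rmax)

/-- The max-plus scalar multiple `a ⊗ v` of a vector. -/
def smulVec (a : Rmax) (v : Fin n → Rmax) : Fin n → Rmax := fun i => a + v i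

/-- The max-plus scalar multiple `a ⊗ A` of a matrix. -/
def smulMat (a : Rmax) (A : Matrix (Fin n) (Fin n) Rmax) : Matrix (Fin n) (Fin n) Rmax :=
  fun i j => a + A i j

/-- The max-plus matrix product: `(A ⊗ B) i j` is the maximum over `k` of `A i k + B k j`. -/
def mul (A B : Matrix (Fin n) (Fin n) Rmax) : Matrix (Fin n) (Fin n) Rmax :=
  fun i j => Finset.univ.sup fun k => A i k + B k j

/-- The max-plus matrix-vector product: `(A ⊗ v) i` is the maximum over `k` of `A i k + v k`. -/
def mulVec (A : Matrix (Fin n) (Fin n) Rmax) (v : Fin n → Rmax) : Fin n → Rmax :=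
  fun i => Finset.univ.sup fun k => A i k + v k

/-- The max-plus identity matrix: `0` on the diagonal and `-∞` elsewhere. -/
def idMat : Matrix (Fin n) (Fin n) Rmax := fun i j => if i = j then 0 else ⊥

/-- The max-plus matrix power `A ⊗ ⋯ ⊗ A` (`k` factors). -/
def pow (A : Matrix (Fin n) (Fin n) Rmax) : ℕ → Matrix (Fin n) (Fin n) Rmax
  | 0 => idMat
  | k + 1 => mul (pow A k) A

/-- Column `i` of a matrix. -/
def col (A : Matrix (Fin n) (Fin n) Rmax) (i : Fin n) : Fin n → Rmax := fun j => A j i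

/-- A matrix is regular if each row has at least one finite element. -/
def IsRegular (A : Matrix (Fin n) (Fin n) Rmax) : Prop := ∀ i, ∃ j, A i j ≠ ⊥

/-- `a` is a max-plus eigenvalue of `A`: there is a vector over `Rmax`, not identically `-∞`,
with `A ⊗ v = a ⊗ v`. -/
def IsEigenvalue (A : Matrix (Fin n) (Fin n) Rmax) (a : Rmax) : Prop :=
  ∃ v : Fin n → Rmax, (∃ i, v i ≠ ⊥) ∧ mulVec A v = smulVec a v

/-- The real number `l` is the maximum eigenvalue of `A`. -/
def IsMaxEigenvalue (A : Matrix (Fin n) (Fin n) Rmax) (l : ℝ) : Prop :=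
  IsGreatest {a : Rmax | IsEigenvalue A a} (l : Rmax)

/-- The eigenspace of `A` for the eigenvalue `l`: only eigenvectors with finite entries count. -/
def eigenspace (A : Matrix (Fin n) (Fin n) Rmax) (l : ℝ) : Set (Fin n → ℝ) :=
  {x | mulVec A (toRmax x) = smulVec (l : Rmax) (toRmax x)}

/-- The trajectory `x(0), x(1), …` of the max-plus linear system `x(k+1) = A ⊗ x(k)` with
initial vector `x(0) = x`. -/
def traj (A : Matrix (Fin n) (Fin n) Rmax) (x : Fin n → ℝ) : ℕ → (Fin n → Rmax)
  | 0 => toRmax x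
  | k + 1 => mulVec A (traj A x k)

/-- `t` is the local transient of the initial vector `x`, where `l` is the maximum eigenvalue
of `A`: the least `k₀` such that, for some `c ≥ 1`, `x(k+c) = (l * c) ⊗ x(k)` for all `k ≥ k₀`. -/
def IsLocalTransient (A : Matrix (Fin n) (Fin n) Rmax) (l : ℝ) (x : Fin n → ℝ) (t : ℕ) : Prop :=
  IsLeast {k₀ : ℕ | ∃ c : ℕ, 1 ≤ c ∧ ∀ k, k₀ ≤ k →
    traj A x (k + c) = smulVec ((l * c : ℝ) : Rmax) (traj A x k)} t

/-- `t` is the global transient of `A`, where `l` is the maximum eigenvalue of `A`: the least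
`k₀` such that, for some `c ≥ 1`, `A^(k+c) = (l * c) ⊗ A^k` for all `k ≥ k₀`. -/
def IsGlobalTransient (A : Matrix (Fin n) (Fin n) Rmax) (l : ℝ) (t : ℕ) : Prop :=
  IsLeast {k₀ : ℕ | ∃ c : ℕ, 1 ≤ c ∧ ∀ k, k₀ ≤ k →
    pow A (k + c) = smulMat ((l * c : ℝ) : Rmax) (pow A k)} t

/-- The system `x(k+1) = A ⊗ x(k)` with maximum eigenvalue `l` is unboundedly periodic: each
initial vector in `ℝⁿ` has a local transient, but `A` has no global transient. -/
def IsUnboundedlyPeriodic (A : Matrix (Fin n) (Fin n) Rmax) (l : ℝ) : Prop :=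
  (∀ x : Fin n → ℝ, ∃ t, IsLocalTransient A l x t) ∧ ¬ ∃ t, IsGlobalTransient A l t

end MaxPlus

namespace MaxPlus

section Matrices

variable {n : ℕ}

/-! Subtracting a finite eigenvector and the drift `k * l` from a trajectory turns the finite
entries of `A` into increments `≤ 0`, with a zero in every row. The normalized trajectory is thus
bounded below, and only boundedly many nonzero increments can accumulate. It takes finitely many
values (`finite_range_of_increments`), so a state recurs, and by determinism the recurrence
persists. A global period fails because one finite entry of column `i` would have to grow at both
rates `μ` and `l` (`not_pow_periodic_of_col`). -/

lemma add_sup_univ (a : ℝ) (f : Fin n → Rmax) :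
    (a : Rmax) + Finset.univ.sup f = Finset.univ.sup fun k => (a : Rmax) + f k := by
  refine Finset.apply_sup_eq_sup_comp (fun b : Rmax => (a : Rmax) + b) (fun x y => ?_) ?_
  · exact Monotone.map_sup (f := fun b : Rmax => (a : Rmax) + b) (fun _ _ h => add_le_add_right h _) x y
  · simp

lemma mulVec_smulVec (A : Matrix (Fin n) (Fin n) Rmax) (a : ℝ) (v : Fin n → Rmax) :
    mulVec A (smulVec a v) = smulVec a (mulVec A v) := by
  funext i
  simp only [mulVec, smulVec]
  rw [add_sup_univ]
  exact congrArg _ (funext fun k => add_left_comm _ _ _)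

/-- The product with a vector attains its maximum. -/
lemma exists_mulVec_eq (A : Matrix (Fin n) (Fin n) Rmax) (v : Fin n → Rmax) (i : Fin n) :
    ∃ j, mulVec A v i = A i j + v j := by
  obtain ⟨j, -, hj⟩ := Finset.exists_mem_eq_sup Finset.univ ⟨i, Finset.mem_univ i⟩
    (fun k => A i k + v k)
  exact ⟨j, hj⟩

lemma le_mulVec (A : Matrix (Fin n) (Fin n) Rmax) (v : Fin n → Rmax) (i j : Fin n) :
    A i j + v j ≤ mulVec A v i :=
  Finset.le_sup (f := fun k => A i k + v k) (Finset.mem_univ j)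

lemma IsRegular.exists_mulVec_toRmax {A : Matrix (Fin n) (Fin n) Rmax} (hA : IsRegular A)
    (x : Fin n → ℝ) : ∃ y : Fin n → ℝ, mulVec A (toRmax x) = toRmax y := by
  have h : ∀ i, ∃ r : ℝ, (r : Rmax) = mulVec A (toRmax x) i := fun i => by
    obtain ⟨j, hj⟩ := hA i
    refine WithBot.ne_bot_iff_exists.1 (ne_bot_of_le_ne_bot ?_ (le_mulVec A (toRmax x) i j))
    simp [toRmax, hj]
  choose y hy using h
  exact ⟨y, funext fun i => (hy i).symm⟩

lemma IsRegular.exists_traj_eq {A : Matrix (Fin n) (Fin n) Rmax} (hA : IsRegular A)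
    (x : Fin n → ℝ) : ∃ z : ℕ → Fin n → ℝ, ∀ k, traj A x k = toRmax (z k) := by
  have h : ∀ k, ∃ z : Fin n → ℝ, traj A x k = toRmax z := fun k => by
    induction k with
    | zero => exact ⟨x, rfl⟩
    | succ k ih =>
      obtain ⟨z, hz⟩ := ih
      obtain ⟨y, hy⟩ := hA.exists_mulVec_toRmax z
      exact ⟨y, by rw [traj, hz, hy]⟩
  choose z hz using h
  exact ⟨z, hz⟩

/-- A shift relation along a trajectory persists. -/
lemma traj_add_eq_of_le {A : Matrix (Fin n) (Fin n) Rmax} {x : Fin n → ℝ} {a : ℝ} {k₀ c : ℕ}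
    (h : traj A x (k₀ + c) = smulVec a (traj A x k₀)) {k : ℕ} (hk : k₀ ≤ k) :
    traj A x (k + c) = smulVec a (traj A x k) := by
  induction k, hk using Nat.le_induction with
  | base => exact h
  | succ k _ ih => rw [Nat.add_right_comm, traj, ih, mulVec_smulVec, traj]

/-- A column relation with a real shift, repeated `m` times. -/
lemma col_pow_add_mul {A : Matrix (Fin n) (Fin n) Rmax} {i j : Fin n} {k₀ c : ℕ} {a : ℝ}
    (h : ∀ k, k₀ ≤ k → pow A (k + c) j i = (a : Rmax) + pow A k j i) (m : ℕ) {k : ℕ}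
    (hk : k₀ ≤ k) : pow A (k + m * c) j i = ((m * a : ℝ) : Rmax) + pow A k j i := by
  induction m with
  | zero => simp
  | succ m ih =>
    rw [Nat.succ_mul, ← add_assoc, h _ (hk.trans (Nat.le_add_right _ _)), ih, ← add_assoc,
      ← WithBot.coe_add]
    congr 2
    push_cast
    ring

end Matrices

/-- A sequence of vectors that is bounded below takes only finitely many values if each new
coordinate is an old one plus a nonpositive increment from a fixed finite set. -/
lemma finite_range_of_increments {ι : Type*} [Finite ι] {D : Set ℝ} (hD : D.Finite)
    (hD0 : ∀ d ∈ D, d ≤ 0) {y : ℕ → ι → ℝ} {b : ℝ} (hb : ∀ k i, b ≤ y k i)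
    (hstep : ∀ k i, ∃ j, ∃ d ∈ D, y (k + 1) i = d + y k j) : (Set.range y).Finite := by
  -- Finiteness of `D` separates its negative elements from `0`.
  obtain ⟨δ, hδ, hgap⟩ : ∃ δ > 0, ∀ d ∈ D, d = 0 ∨ d ≤ -δ := by
    rcases (D \ {0}).eq_empty_or_nonempty with h | h
    · exact ⟨1, one_pos, fun d hd => Or.inl (Set.sdiff_eq_empty.1 h hd)⟩
    · obtain ⟨e, ⟨heD, he0⟩, hmax⟩ := Set.exists_max_image _ id hD.sdiff h
      refine ⟨-e, neg_pos.2 (lt_of_le_of_ne (hD0 e heD) he0), fun d hd => ?_⟩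
      by_cases hd0 : d = 0
      · exact Or.inl hd0
      · exact Or.inr ((neg_neg e).symm ▸ hmax d ⟨hd, hd0⟩)
  obtain ⟨M, hM⟩ := (Set.finite_range (y 0)).bddAbove
  -- Initial coordinates plus `m` increments from `D`.
  let G : ℕ → Set ℝ := fun m => Nat.rec (Set.range (y 0)) (fun _ S => Set.image2 (· + ·) D S) m
  have hG : ∀ m, (G m).Finite := fun m => by
    induction m with
    | zero => exact Set.finite_range _
    | succ m ih => exact hD.image2 _ ih
  -- Here `m` counts only the negative increments; each costs at least `δ`, so `m` is bounded
  -- independently of `k`.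
  have key : ∀ k i, ∃ m : ℕ, y k i ∈ G m ∧ m * δ ≤ M - y k i := fun k => by
    induction k with
    | zero => exact fun i => ⟨0, ⟨i, rfl⟩, by simpa using hM ⟨i, rfl⟩⟩
    | succ k ih =>
      intro i
      obtain ⟨j, d, hd, hy⟩ := hstep k i
      obtain ⟨m, hm, hle⟩ := ih j
      rcases hgap d hd with rfl | hd'
      · exact ⟨m, by rwa [hy, zero_add], by rwa [hy, zero_add]⟩
      · refine ⟨m + 1, ⟨d, hd, y k j, hm, hy.symm⟩, ?_⟩
        push_cast
        linarith
  obtain ⟨N, hN⟩ := exists_nat_ge ((M - b) / δ)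
  refine (Set.Finite.pi' fun _ : ι => (Set.finite_Iic N).biUnion fun m _ => hG m).subset ?_
  rintro _ ⟨k, rfl⟩ i
  obtain ⟨m, hm, hle⟩ := key k i
  refine Set.mem_biUnion (Set.mem_Iic.2 ?_) hm
  have : (m : ℝ) ≤ (M - b) / δ := (le_div_iff₀ hδ).2 (hle.trans (by linarith [hb k i]))
  exact_mod_cast this.trans hN

/-- If the regular matrix `A` has a finite eigenvector for `l`, then every trajectory with finite
initial vector is eventually periodic with growth rate `l`. -/
lemma IsRegular.exists_traj_periodic {n : ℕ} {A : Matrix (Fin n) (Fin n) Rmax}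
    (hA : IsRegular A) {l : ℝ} (hE : (eigenspace A l).Nonempty) (x : Fin n → ℝ) :
    ∃ k₀ c : ℕ, 1 ≤ c ∧ ∀ k, k₀ ≤ k →
      traj A x (k + c) = smulVec ((l * c : ℝ) : Rmax) (traj A x k) := by
  obtain ⟨v, hv⟩ := hE
  obtain ⟨z, hz⟩ := hA.exists_traj_eq x
  have hzs : ∀ k, mulVec A (toRmax (z k)) = toRmax (z (k + 1)) := fun k => by
    rw [← hz, ← hz, traj]
  have hv' : ∀ i, mulVec A (toRmax v) i = ((l + v i : ℝ) : Rmax) := fun i => congrFun hv i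
  let y : ℕ → Fin n → ℝ := fun k i => z k i - k * l - v i
  -- The default `0` for `⊥` entries may add spurious increments; this is harmless, since only
  -- finiteness and sign matter. Increments from finite entries are `≤ 0` by the eigenvector
  -- equation, so the cut loses none of them.
  let D : Set ℝ := Set.range (fun p : Fin n × Fin n => (A p.1 p.2).unbotD 0 + v p.2 - v p.1 - l) ∩
    Set.Iic 0
  have hy_max : ∀ k i, ∃ j, ∃ d ∈ D, y (k + 1) i = d + y k j := fun k i => by
    obtain ⟨j, hj⟩ := exists_mulVec_eq A (toRmax (z k)) i
    rw [hzs] at hj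
    have hne : A i j ≠ ⊥ := by
      rintro h
      simp [h, toRmax] at hj
    obtain ⟨a, ha⟩ := WithBot.ne_bot_iff_exists.1 hne
    have hle := le_mulVec A (toRmax v) i j
    rw [hv', ← ha, toRmax, ← WithBot.coe_add, WithBot.coe_le_coe] at hle
    rw [← ha, toRmax, toRmax, ← WithBot.coe_add, WithBot.coe_inj] at hj
    refine ⟨j, a + v j - v i - l, ⟨⟨(i, j), by simp [← ha]⟩, ?_⟩, ?_⟩
    · rw [Set.mem_Iic]
      linarith
    · simp only [y, hj]
      push_cast
      ring
  -- An entry attaining the maximum in row `i` of the eigenvector equation has increment zero, so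
  -- the least coordinate never decreases.
  have hy_ge : ∀ k i, ∃ j, y k j ≤ y (k + 1) i := fun k i => by
    obtain ⟨j, hj⟩ := exists_mulVec_eq A (toRmax v) i
    rw [hv'] at hj
    have hne : A i j ≠ ⊥ := by
      rintro h
      simp [h] at hj
    obtain ⟨a, ha⟩ := WithBot.ne_bot_iff_exists.1 hne
    have hle := le_mulVec A (toRmax (z k)) i j
    rw [hzs, ← ha, toRmax, toRmax, ← WithBot.coe_add, WithBot.coe_le_coe] at hle
    rw [← ha, toRmax, ← WithBot.coe_add, WithBot.coe_inj] at hj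
    refine ⟨j, ?_⟩
    simp only [y]
    push_cast
    linarith
  obtain ⟨b, hb⟩ := (Set.finite_range (y 0)).bddBelow
  have hyb : ∀ k i, b ≤ y k i := fun k => by
    induction k with
    | zero => exact fun i => hb ⟨i, rfl⟩
    | succ k ih =>
      intro i
      obtain ⟨j, hj⟩ := hy_ge k i
      exact (ih j).trans hj
  have hfin := finite_range_of_increments ((Set.finite_range _).inter_of_left _)
    (fun d hd => hd.2) hyb hy_max
  have hninj : ¬ Function.Injective y := fun h => Set.infinite_range_of_injective h hfin
  obtain ⟨p, q, hpq, hlt⟩ : ∃ p q, y p = y q ∧ p < q := by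
    simp only [Function.Injective, not_forall] at hninj
    obtain ⟨p, q, h, hne⟩ := hninj
    rcases lt_or_gt_of_ne hne with h' | h'
    exacts [⟨p, q, h, h'⟩, ⟨q, p, h.symm, h'⟩]
  obtain ⟨c, rfl⟩ := Nat.exists_eq_add_of_le hlt.le
  refine ⟨p, c, by omega, fun k hk => traj_add_eq_of_le ?_ hk⟩
  rw [hz, hz]
  funext i
  rw [toRmax, smulVec, toRmax, ← WithBot.coe_add, WithBot.coe_inj]
  have := congrFun hpq i
  simp only [y] at this
  push_cast at this
  linarith

/-- A column of the powers that is not identically `-∞` and eventually periodic with growth rate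
other than `l` rules out a global period of the powers with growth rate `l`. -/
lemma not_pow_periodic_of_col {n : ℕ} {A : Matrix (Fin n) (Fin n) Rmax} {l μ : ℝ} (hμ : μ ≠ l)
    {i : Fin n} {k₀ c : ℕ} (hc : 1 ≤ c) (hfin : ∃ j, col (pow A k₀) i j ≠ ⊥)
    (hcol : ∀ k, k₀ ≤ k →
      col (pow A (k + c)) i = smulVec ((μ * c : ℝ) : Rmax) (col (pow A k) i)) :
    ¬ ∃ t d : ℕ, 1 ≤ d ∧ ∀ k, t ≤ k →
      pow A (k + d) = smulMat ((l * d : ℝ) : Rmax) (pow A k) := by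
  rintro ⟨t, d, hd, hglob⟩
  obtain ⟨j, hj⟩ := hfin
  have hμstep := fun m => @col_pow_add_mul n A i j k₀ c (μ * c)
    (fun k hk => congrFun (hcol k hk) j) m
  have hlstep := fun m => @col_pow_add_mul n A i j t d (l * d)
    (fun k hk => congrFun (congrFun (hglob k hk) j) i) m
  -- Moving by a multiple of `c` passes `t` while keeping the entry finite.
  have htc : t ≤ k₀ + t * c := (Nat.le_mul_of_pos_right t hc).trans (Nat.le_add_left _ _)
  have hne : pow A (k₀ + t * c) j i ≠ ⊥ := by
    rw [hμstep t le_rfl]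
    exact WithBot.add_ne_bot.2 ⟨WithBot.coe_ne_bot, hj⟩
  obtain ⟨a, ha⟩ := WithBot.ne_bot_iff_exists.1 hne
  -- The common shift `d * c` allows both growth rates to be compared on the same entry.
  have h₁ := hμstep d (Nat.le_add_right k₀ (t * c))
  have h₂ := hlstep c htc
  rw [mul_comm c d] at h₂
  rw [h₂, ← ha, ← WithBot.coe_add, ← WithBot.coe_add, WithBot.coe_inj] at h₁
  have hpos : (0 : ℝ) < d * c := by
    exact_mod_cast Nat.mul_pos hd hc
  exact hμ (mul_left_cancel₀ hpos.ne' (by linarith))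

end MaxPlus

theorem proposition4 {n : ℕ} (A : Matrix (Fin n) (Fin n) MaxPlus.Rmax)
    (hA : MaxPlus.IsRegular A) (l : ℝ) (hl : MaxPlus.IsMaxEigenvalue A l)
    (hE : (MaxPlus.eigenspace A l).Nonempty)
    (i : Fin n) (k₀ c : ℕ) (hc : 1 ≤ c) (μ : ℝ) (hμ : μ < l)
    (hfin : ∃ j, MaxPlus.col (MaxPlus.pow A k₀) i j ≠ ⊥)
    (hcol : ∀ k, k₀ ≤ k → MaxPlus.col (MaxPlus.pow A (k + c)) i =
      MaxPlus.smulVec ((μ * c : ℝ) : MaxPlus.Rmax) (MaxPlus.col (MaxPlus.pow A k) i)) :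
    MaxPlus.IsUnboundedlyPeriodic A l := by
  refine ⟨fun x => ?_, ?_⟩
  · classical
    have h := hA.exists_traj_periodic hE x
    exact ⟨Nat.find h, Nat.find_spec h, fun _ hk => Nat.find_min' h hk⟩
  · rintro ⟨t, ht, -⟩
    exact MaxPlus.not_pow_periodic_of_col hμ.ne hc hfin hcol ⟨t, ht⟩
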